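/- For $n\ge 3$ let $GVB_n$ be Fang's generalized virtual braid group, that is, the group with generators $\sigma_1,\dots,\sigma_{n-1},\rho_1,\dots,\rho_{n-1}$ and defining relations \begin{align*} &\sigma_i\sigma_j=\sigma_j\sigma_i,\quad \rho_i\rho_j=\rho_j\rho_i,\quad \sigma_i\rho_j=\rho_j\sigma_i &&(1\le i,j\le n-1,\ |i-j|>1),\\ &\sigma_i\sigma_{i+1}\sigma_i=\sigma_{i+1}\sigma_i\sigma_{i+1},\quad \rho_i\rho_{i+1}\rho_i=\rho_{i+1}\rho_i\rho_{i+1} &&(1\le i\le n-2),\\ &\rho_i\sigma_{i+1}\sigma_i=\sigma_{i+1}\sigma_i\rho_{i+1},\quad \rho_{i+1}\sigma_i\sigma_{i+1}=\sigma_i\sigma_{i+1}\rho_i &&(1\le i\le n-2), \end{align*} and let $GVB_n'=[GVB_n,GVB_n]$ be its commutator subgroup. Then: (i) $GVB_n'$ is finitely generated for all $n\ge 4$; moreover, for $n\ge 5$, the rank of $GVB_n'$ (the smallest size of a generating set) is at most $3n-7$. (ii) There is a surjective homomorphism from $GVB_3'$ onto a free group of countably infinite rank, and $GVB_3'$ is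 not finitely generated. (iii) For $n\ge 3$, the group $GVB_n'$ is perfect (equal to its own commutator subgroup) if and only if $n\ge 5$. -/

import Mathlib

namespace GVBraid

/-- The generators `σ_i`, `ρ_i` of `GVB_n`, indexed by the `n - 1` elements of `Fin (n - 1)`
(the index `i : Fin (n - 1)` stands for `i + 1` in the usual numbering `1, …, n - 1`). -/
inductive Gen (n : ℕ) : Type
  | sigma (i : Fin (n - 1)) : Gen n
  | rho (i : Fin (n - 1)) : Gen n

/-- The free generator `σ_i`. -/
def σ {n : ℕ} (i : Fin (n - 1)) : FreeGroup (Gen n) := FreeGroup.of (Gen.sigma i)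

/-- The free generator `ρ_i`. -/
def ρ {n : ℕ} (i : Fin (n - 1)) : FreeGroup (Gen n) := FreeGroup.of (Gen.rho i)

/-- `Rel n u v` says that `u = v` is one of the defining relations of `GVB_n`. -/
inductive Rel (n : ℕ) : FreeGroup (Gen n) → FreeGroup (Gen n) → Prop
  | sigma_comm (i j : Fin (n - 1)) (h : 1 < |((i : ℕ) : ℤ) - ((j : ℕ) : ℤ)|) :
      Rel n (σ i * σ j) (σ j * σ i)
  | sigma_braid (i j : Fin (n - 1)) (h : (j : ℕ) = (i : ℕ) + 1) :
      Rel n (σ i * σ j * σ i) (σ j * σ i * σ j)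
  | rho_comm (i j : Fin (n - 1)) (h : 1 < |((i : ℕ) : ℤ) - ((j : ℕ) : ℤ)|) :
      Rel n (ρ i * ρ j) (ρ j * ρ i)
  | rho_braid (i j : Fin (n - 1)) (h : (j : ℕ) = (i : ℕ) + 1) :
      Rel n (ρ i * ρ j * ρ i) (ρ j * ρ i * ρ j)
  | mixed_left (i j : Fin (n - 1)) (h : (j : ℕ) = (i : ℕ) + 1) :
      Rel n (ρ i * σ j * σ i) (σ j * σ i * ρ j)
  | mixed_right (i j : Fin (n - 1)) (h : (j : ℕ) = (i : ℕ) + 1) :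
      Rel n (ρ j * σ i * σ j) (σ i * σ j * ρ i)
  | mixed_comm (i j : Fin (n - 1)) (h : 1 < |((i : ℕ) : ℤ) - ((j : ℕ) : ℤ)|) :
      Rel n (σ i * ρ j) (ρ j * σ i)

/-- The relators `u v⁻¹` of `GVB_n`. -/
def relators (n : ℕ) : Set (FreeGroup (Gen n)) :=
  {r | ∃ u v : FreeGroup (Gen n), Rel n u v ∧ r = u * v⁻¹}

/-- Fang's generalized virtual braid group on `n` strands. -/
abbrev GVB (n : ℕ) : Type := PresentedGroup (relators n)

/-- A group is perfect if it equals its own commutator subgroup. -/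
def IsPerfect (G : Type*) [Group G] : Prop := commutator G = ⊤

end GVBraid

/- Write `s 0, …, s (m - 1)` and `r 0, …, r (m - 1)` for the generators of `GVB (m + 1)`, and `A`,
`B` for the derived subgroups of the braid groups on the two chains. For `3 ≤ m` the commutator
subgroup is generated by the conjugates of `A` and `B` under the powers of `s 0`: modulo this
subgroup the generators of each chain agree, and `s 0` commutes with `r 2`. A generator of `B` that
commutes with an element congruent to a positive power of `s 0` modulo `A` needs only finitely many
of these conjugates. For `m = 3` such an element is `s 2 * s 1 * s 0 * (s 0 * s 1 * s 2)`; for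
`4 ≤ m` it is some `s k`, except for the ratio of `r 0` and `r 3`, settled by a short computation.

For `4 ≤ m` the ratio of the first two generators of a chain is a commutator of their quotients by
the fourth, whence perfectness; for `m ≤ 3` the map onto `S₃` with kernel containing the `ρ_i`
obstructs it. Finally, `GVB 3` acts on the free group on `ℤ`: each `ρ_i` shifts the letters, and
each `σ_i` inverts them and then multiplies on the left by the letter `0`. The commutator subgroup
acts by left translations, by enough of them to map onto a free group of infinite rank. -/

namespace GVBraid

open Subgroup
open scoped commutatorElement

section Conjugation

variable {G : Type*} [Group G] {H N : Subgroup G} {g h r t x y z : G}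

theorem inv_mul_mem_of_mem_normalizer (hh : h ∈ normalizer (H : Set G)) (hgh : g * h⁻¹ ∈ H) :
    g⁻¹ * h ∈ H := by
  simpa [mul_assoc] using (mem_normalizer_iff''.1 hh _).1 (inv_mem hgh)

theorem conj_mem_iff_of_mul_inv_mem (hgh : g * h⁻¹ ∈ H) : g * x * g⁻¹ ∈ H ↔ h * x * h⁻¹ ∈ H := by
  have e : g * x * g⁻¹ = g * h⁻¹ * (h * x * h⁻¹) * (g * h⁻¹)⁻¹ := by group
  rw [e, mul_mem_cancel_right (inv_mem hgh), mul_mem_cancel_left hgh]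

theorem conj_mem_of_commute (hx : x ∈ H) (hhx : Commute h x) (hgh : g * h⁻¹ ∈ H) :
    g * x * g⁻¹ ∈ H := by
  rwa [conj_mem_iff_of_mul_inv_mem hgh, hhx.mul_inv_cancel]

theorem mem_normalizer_of_le_comap (h₁ : H ≤ H.comap (MulAut.conj g).toMonoidHom)
    (h₂ : H ≤ H.comap (MulAut.conj g⁻¹).toMonoidHom) : g ∈ normalizer (H : Set G) :=
  mem_normalizer_iff.2 fun x => ⟨fun hx => h₁ hx, fun hx => by simpa [mul_assoc] using h₂ hx⟩

theorem mem_normalizer_of_mul_inv_mem (hh : h ∈ normalizer (H : Set G)) (hgh : g * h⁻¹ ∈ H) :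
    g ∈ normalizer (H : Set G) := by
  simpa using mul_mem (le_normalizer hgh) hh

theorem mul_mul_inv_pow_mem {a b : ℕ} (ht : t ∈ normalizer (H : Set G))
    (hx : x * (t ^ a)⁻¹ ∈ H) (hy : y * (t ^ b)⁻¹ ∈ H) : x * y * (t ^ (a + b))⁻¹ ∈ H := by
  have h := mul_mem hx ((mem_normalizer_iff.1 (pow_mem ht a) _).1 hy)
  simpa [pow_add, mul_assoc] using h

/-- The elements of the normalizer of `H` that commute with `r` modulo `H`. -/
def centralizerMod (H : Subgroup G) (r : G) : Subgroup G where
  carrier := {g | g ∈ normalizer (H : Set G) ∧ ⁅r, g⁆ ∈ H}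
  one_mem' := ⟨one_mem _, by simp⟩
  mul_mem' := fun {a b} ha hb => ⟨mul_mem ha.1 hb.1, by
    rw [commutatorElement_mul_right_eq_mul_conj, mul_assoc, mul_assoc, ← mul_assoc a]
    exact mul_mem ha.2 ((mem_normalizer_iff.1 ha.1 _).1 hb.2)⟩
  inv_mem' := fun {a} ha => ⟨inv_mem ha.1, by
    rw [commutatorElement_inv_right, ← commutatorElement_inv]
    exact (mem_normalizer_iff''.1 ha.1 _).1 (inv_mem ha.2)⟩

theorem conj_mem_of_mem_centralizerMod (hg : g ∈ H) (hr : g ∈ centralizerMod H r) :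
    r * g * r⁻¹ ∈ H := by
  simpa [commutatorElement_def] using mul_mem hr.2 hg

theorem mem_centralizerMod_of_commute (hy : y ∈ normalizer (H : Set G)) (hzy : Commute z y)
    (hxz : x * z⁻¹ ∈ H) : y ∈ centralizerMod H x := by
  refine ⟨hy, ?_⟩
  have e : ⁅x, y⁆ = x * z⁻¹ * (y * (x * z⁻¹)⁻¹ * y⁻¹) := by
    have hzy' : z⁻¹ * y * z = y := by rw [hzy.inv_left.eq, inv_mul_cancel_right]
    nth_rw 1 [commutatorElement_def, ← hzy']
    group
  exact e ▸ mul_mem hxz ((mem_normalizer_iff.1 hy _).1 (inv_mem hxz))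

theorem commutator_le_of_closure_eq_top [N.Normal] {S : Set G} (hS : closure S = ⊤)
    (h : ∀ x ∈ S, ∀ y ∈ S, ⁅x, y⁆ ∈ N) : commutator G ≤ N := by
  have eq_top {r : G} (hr : ∀ x ∈ S, ⁅r, x⁆ ∈ N) : centralizerMod N r = ⊤ := by
    rw [eq_top_iff, ← hS, closure_le]
    exact fun x hx => ⟨by simp [normalizer_eq_top], hr x hx⟩
  have h₁ : ∀ x ∈ S, ∀ y, ⁅x, y⁆ ∈ N := fun x hx y =>
    (eq_top (h x hx) ▸ mem_top y : y ∈ centralizerMod N x).2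
  rw [commutator_def, commutator_le]
  refine fun y _ x _ => (eq_top (fun z hz => ?_) ▸ mem_top x : x ∈ centralizerMod N y).2
  simpa using inv_mem (h₁ z hz y)

theorem mem_normalizer_sup_closure {T : Set G} (hg : g ∈ normalizer (H : Set G))
    (h₁ : ∀ x ∈ T, g * x * g⁻¹ ∈ H ⊔ closure T) (h₂ : ∀ x ∈ T, g⁻¹ * x * g ∈ H ⊔ closure T) :
    g ∈ normalizer ((H ⊔ closure T : Subgroup G) : Set G) :=
  mem_normalizer_of_le_comap
    (sup_le (fun _ hx => mem_sup_left ((mem_normalizer_iff.1 hg _).1 hx)) ((closure_le _).2 h₁))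
    (sup_le (fun x hx => mem_sup_left ((mem_normalizer_iff.1 (inv_mem hg) x).1 hx))
      ((closure_le _).2 fun x hx => by simpa using h₂ x hx))

theorem mem_normalizer_closure {T : Set G} (h₁ : ∀ x ∈ T, g * x * g⁻¹ ∈ closure T)
    (h₂ : ∀ x ∈ T, g⁻¹ * x * g ∈ closure T) : g ∈ normalizer (closure T : Set G) := by
  simpa using mem_normalizer_sup_closure (H := ⊥) (mem_normalizer_iff.2 (by simp))
    (by simpa using h₁) (by simpa using h₂)

/-- The smallest subgroup containing `S` that is normalized by `t`. -/
def conjClosure (t : G) (S : Set G) : Subgroup G :=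
  sInf {L | S ⊆ L ∧ t ∈ normalizer (L : Set G)}

variable {S : Set G}

theorem subset_conjClosure : S ⊆ conjClosure t S := fun _ hx =>
  mem_sInf.2 fun _ hL => hL.1 hx

theorem conjClosure_le (hS : S ⊆ H) (ht : t ∈ normalizer (H : Set G)) : conjClosure t S ≤ H :=
  sInf_le ⟨hS, ht⟩

theorem mem_normalizer_conjClosure : t ∈ normalizer (conjClosure t S : Set G) := by
  refine mem_normalizer_iff.2 fun x => ?_
  rw [conjClosure, mem_sInf, mem_sInf]
  exact forall₂_congr fun L hL => mem_normalizer_iff.1 hL.2 x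

theorem conjClosure_le_comap_conj (ht : t ∈ centralizerMod (conjClosure t S) r)
    (hS : ∀ x ∈ S, r * x * r⁻¹ ∈ conjClosure t S) :
    conjClosure t S ≤ (conjClosure t S).comap (MulAut.conj r).toMonoidHom := by
  refine conjClosure_le hS (mem_normalizer_iff.2 fun x => ?_)
  have hrt : r * t * (t * r)⁻¹ ∈ conjClosure t S := by
    simpa [commutatorElement_def, mul_assoc] using ht.2
  have e : ∀ a b : G, a * (b * x * b⁻¹) * a⁻¹ = a * b * x * (a * b)⁻¹ := fun a b => by group
  change r * x * r⁻¹ ∈ conjClosure t S ↔ r * (t * x * t⁻¹) * r⁻¹ ∈ conjClosure t S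
  rw [e, conj_mem_iff_of_mul_inv_mem hrt, ← e]
  exact mem_normalizer_iff.1 ht.1 _

/-- Modulo `K`, conjugation of `X` by `t ^ (k + 1)` agrees with conjugation by `w`, which is
trivial, so finitely many powers of `t` suffice. -/
theorem mem_normalizer_sup_conj_pow {K : Subgroup G} {X : Set G} {w : G} {k : ℕ}
    (ht : t ∈ normalizer (K : Set G)) (hwX : ∀ x ∈ X, Commute w x) (hw : w * (t ^ (k + 1))⁻¹ ∈ K) :
    t ∈ normalizer ((K ⊔ closure (Set.image2 (fun j x => t ^ j * x * (t ^ j)⁻¹) (Set.Iic k) X) :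
      Subgroup G) : Set G) := by
  set L := K ⊔ closure (Set.image2 (fun j x => t ^ j * x * (t ^ j)⁻¹) (Set.Iic k) X)
  have conj_pow_mem {j : ℕ} (hj : j ≤ k) {x : G} (hx : x ∈ X) : t ^ j * x * (t ^ j)⁻¹ ∈ L :=
    mem_sup_right (subset_closure ⟨j, hj, x, hx, rfl⟩)
  refine mem_normalizer_sup_closure ht ?_ ?_
  · rintro _ ⟨j, hj, x, hx, rfl⟩
    have e : t * (t ^ j * x * (t ^ j)⁻¹) * t⁻¹ = t ^ (j + 1) * x * (t ^ (j + 1))⁻¹ := by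
      simp [pow_succ', mul_assoc]
    change _ ∈ L
    rw [e]
    obtain rfl | hjk := (Set.mem_Iic.1 hj).eq_or_lt
    · have hw' : t ^ (j + 1) * w⁻¹ ∈ L := mem_sup_left (by simpa using inv_mem hw)
      exact conj_mem_of_commute (by simpa using conj_pow_mem j.zero_le hx) (hwX x hx) hw'
    · exact conj_pow_mem hjk hx
  · rintro _ ⟨_ | j, hj, x, hx, rfl⟩
    · have hw' : t⁻¹ * w * (t ^ k)⁻¹ ∈ L := by
        refine mem_sup_left ?_
        simpa [pow_succ', mul_assoc] using (mem_normalizer_iff''.1 ht _).1 hw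
      have h := (conj_mem_iff_of_mul_inv_mem hw').2 (conj_pow_mem le_rfl hx)
      rw [← (hwX x hx).mul_inv_cancel]
      change _ ∈ L
      simpa [mul_assoc] using h
    · change _ ∈ L
      simpa [pow_succ', mul_assoc] using conj_pow_mem (Nat.le_of_succ_le hj) hx

theorem conjClosure_fg {K : Subgroup G} {X : Set G} {w : G} {k : ℕ} (hK : K.FG) (hX : X.Finite)
    (ht : t ∈ normalizer (K : Set G)) (hwX : ∀ x ∈ X, Commute w x) (hw : w * (t ^ (k + 1))⁻¹ ∈ K) :
    (conjClosure t (K ∪ X)).FG := by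
  let T : Set G := Set.image2 (fun j x => t ^ j * x * (t ^ j)⁻¹) (Set.Iic k) X
  have hXT : X ⊆ (K ⊔ closure T : Subgroup G) := fun x hx =>
    mem_sup_right (subset_closure ⟨0, k.zero_le, x, hx, by simp⟩)
  have heq : conjClosure t (K ∪ X) = K ⊔ closure T := by
    refine le_antisymm (conjClosure_le (Set.union_subset (le_sup_left (a := K)) hXT)
      (mem_normalizer_sup_conj_pow ht hwX hw))
      (sup_le (Set.subset_union_left.trans subset_conjClosure) ((closure_le _).2 ?_))
    rintro _ ⟨j, -, x, hx, rfl⟩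
    exact (mem_normalizer_iff.1 (pow_mem mem_normalizer_conjClosure j) x).1
      (subset_conjClosure (Or.inr hx))
  rw [heq]
  exact hK.sup ((fg_iff _).2 ⟨T, rfl, (Set.finite_Iic k).image2 _ hX⟩)

end Conjugation

section Relations

variable {G : Type*} [Group G] {N : Subgroup G} {m : ℕ} {r s t : ℕ → G} {i : ℕ}

/-- Far commutation between the chains `s 0, …, s (m - 1)` and `t 0, …, t (m - 1)`, together with
the relations by which `s i * s (i + 1)` and `s (i + 1) * s i` move `t i` to `t (i + 1)` and back.
For `t = s` these are the braid relations, for two different chains the mixed relations of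
`GVB (m + 1)`. -/
structure Shifts (m : ℕ) (s t : ℕ → G) : Prop where
  comm : ∀ i < m, ∀ j < m, i + 1 < j ∨ j + 1 < i → Commute (s i) (t j)
  up : ∀ i, i + 1 < m → SemiconjBy (s i * s (i + 1)) (t i) (t (i + 1))
  down : ∀ i, i + 1 < m → SemiconjBy (s (i + 1) * s i) (t (i + 1)) (t i)

namespace Shifts

theorem up_three_left (h : Shifts m s t) (hi : i + 2 < m) :
    SemiconjBy (s i * s (i + 1) * s (i + 2)) (t i) (t (i + 1)) :=
  (h.up i (by lia)).mul_left (h.comm (i + 2) hi i (by lia) (by lia))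

theorem up_three_right (h : Shifts m s t) (hi : i + 2 < m) :
    SemiconjBy (s i * s (i + 1) * s (i + 2)) (t (i + 1)) (t (i + 2)) := by
  rw [mul_assoc]
  exact SemiconjBy.mul_left (h.comm i (by lia) (i + 2) hi (by lia)) (h.up (i + 1) hi)

theorem down_three_left (h : Shifts m s t) (hi : i + 2 < m) :
    SemiconjBy (s (i + 2) * s (i + 1) * s i) (t (i + 1)) (t i) := by
  rw [mul_assoc]
  exact SemiconjBy.mul_left (h.comm (i + 2) hi i (by lia) (by lia)) (h.down i (by lia))

theorem down_three_right (h : Shifts m s t) (hi : i + 2 < m) :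
    SemiconjBy (s (i + 2) * s (i + 1) * s i) (t (i + 2)) (t (i + 1)) :=
  (h.down (i + 1) hi).mul_left (h.comm i (by lia) (i + 2) hi (by lia))

theorem conj_mul_inv (h : Shifts m s t) (hi : i + 2 < m) :
    s i * s (i + 1) * s (i + 2) * (t (i + 1) * (t i)⁻¹) * (s i * s (i + 1) * s (i + 2))⁻¹ =
      t (i + 2) * (t (i + 1))⁻¹ :=
  mul_inv_eq_of_eq_mul
    ((h.up_three_right hi).mul_right (h.up_three_left hi).inv_right).eq

theorem mul_inv_mem_of_normal [N.Normal] (h : Shifts m s t) (h₁ : t 1 * (t 0)⁻¹ ∈ N) :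
    ∀ i < m, t i * (t 0)⁻¹ ∈ N := by
  have succ : ∀ i, i + 1 < m → t (i + 1) * (t i)⁻¹ ∈ N := by
    intro i
    induction i with
    | zero => exact fun _ => h₁
    | succ i ih =>
      intro hi
      rw [← h.conj_mul_inv hi]
      exact Normal.conj_mem inferInstance _ (ih (by lia)) _
  intro i
  induction i with
  | zero => simp
  | succ i ih =>
    intro hi
    simpa [mul_assoc] using mul_mem (succ i hi) (ih (by lia))

theorem commute_three (h : Shifts m s t) (hm : 3 ≤ m) (hi : i < 2) :
    Commute (s 2 * s 1 * s 0 * (s 0 * s 1 * s 2)) (t i) := by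
  obtain rfl | rfl : i = 0 ∨ i = 1 := by lia
  · exact SemiconjBy.mul_left (h.down_three_left hm) (h.up_three_left hm)
  · exact SemiconjBy.mul_left (h.down_three_right hm) (h.up_three_right hm)

theorem commutatorElement_mul_left (h : Shifts m t t) (hm : 1 < m) :
    ⁅t 0 * t 1, t 0⁆ = t 1 * (t 0)⁻¹ := by
  rw [commutatorElement_def, (h.up 0 hm).eq]
  group

theorem conj_conj_mul_inv (h : Shifts m t t) (hm : 1 < m) :
    t 0 * (t 0 * (t 1 * (t 0)⁻¹) * (t 0)⁻¹) * (t 0)⁻¹ =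
      (t 1 * (t 0)⁻¹)⁻¹ * (t 0 * (t 1 * (t 0)⁻¹) * (t 0)⁻¹) := by
  have e : (t 1)⁻¹ * t 0 * t 1 = t 0 * t 1 * (t 0)⁻¹ := by
    rw [eq_mul_inv_iff_mul_eq, mul_assoc _ (t 1), mul_assoc, inv_mul_eq_iff_eq_mul, ← mul_assoc]
    exact (h.up 0 hm).eq
  calc _ = t 0 * (t 0 * t 1 * (t 0)⁻¹) * (t 0)⁻¹ * (t 0)⁻¹ := by group
    _ = _ := by rw [← e]; group

theorem inv_conj_mul_inv (h : Shifts m t t) (hm : 1 < m) :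
    (t 0)⁻¹ * (t 1 * (t 0)⁻¹) * t 0 =
      t 1 * (t 0)⁻¹ * (t 0 * (t 1 * (t 0)⁻¹) * (t 0)⁻¹)⁻¹ := by
  have e : t 1 * t 0 * (t 1)⁻¹ = (t 0)⁻¹ * t 1 * t 0 := by
    rw [mul_inv_eq_iff_eq_mul, mul_assoc, mul_assoc, eq_inv_mul_iff_mul_eq, ← mul_assoc]
    exact (h.up 0 hm).eq
  calc _ = (t 0)⁻¹ * t 1 * t 0 * (t 0)⁻¹ := by group
    _ = _ := by rw [← e]; group

theorem mul_inv_mem_commutator (h : Shifts m t t) (hi : i < m) :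
    t i * (t 0)⁻¹ ∈ commutator G := by
  obtain rfl | hm : i = 0 ∨ 1 < m := by lia
  · simp
  · refine h.mul_inv_mem_of_normal ?_ i hi
    rw [← h.commutatorElement_mul_left hm]
    exact commutator_mem_commutator (mem_top _) (mem_top _)

/-- Dividing `t 0` and `t 1` by `t 3`, which commutes with both, moves them into the commutator
subgroup without changing their commutators. -/
theorem mul_inv_mem_commutator_commutator (h : Shifts m t t) (hm : 4 ≤ m) :
    t 1 * (t 0)⁻¹ ∈ ⁅commutator G, commutator G⁆ := by
  have c₀ : Commute (t 0) (t 3) := h.comm 0 (by lia) 3 hm (by lia)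
  have c₁ : Commute (t 1) (t 3) := h.comm 1 (by lia) 3 hm (by lia)
  have h₀ : t 0 * (t 3)⁻¹ ∈ commutator G := by
    simpa using inv_mem (h.mul_inv_mem_commutator hm)
  have h₁ : t 1 * (t 3)⁻¹ ∈ commutator G := by
    simpa using mul_mem (h.mul_inv_mem_commutator (i := 1) (by lia)) h₀
  have e : ⁅t 0 * (t 3)⁻¹ * (t 1 * (t 3)⁻¹), t 0 * (t 3)⁻¹⁆ = t 1 * (t 0)⁻¹ := by
    have c : Commute (t 0 * t 1) (t 3)⁻¹ := (c₀.mul_left c₁).inv_right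
    have c' : Commute ((t 3)⁻¹ * (t 3)⁻¹) (t 0) := c₀.symm.inv_left.mul_left c₀.symm.inv_left
    have swap : t 0 * (t 3)⁻¹ * (t 1 * (t 3)⁻¹) = t 0 * t 1 * ((t 3)⁻¹ * (t 3)⁻¹) :=
      (c₁.symm.inv_left.mul_mul_mul_comm _ _)
    rw [swap, commutatorElement_mul_right_eq_mul_conj, commutatorElement_mul_left_eq_conj_mul,
      c'.commutator_eq, (c.mul_left ((Commute.refl _).mul_left (Commute.refl _))).commutator_eq]
    simpa using h.commutatorElement_mul_left (by lia)
  rw [← e]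
  exact commutator_mem_commutator (mul_mem h₀ h₁) h₀

end Shifts

/-- The chains `s` and `r` satisfy the defining relations of `GVB (m + 1)`, with `s` in the role of
the `σ_i` and `r` in the role of the `ρ_i`. -/
structure Relations (m : ℕ) (s r : ℕ → G) : Prop where
  ss : Shifts m s s
  sr : Shifts m s r
  rr : Shifts m r r

theorem commutator_le_of_generators [N.Normal]
    (hgen : closure (s '' Set.Iio m ∪ r '' Set.Iio m) = ⊤) (hs : ∀ i < m, s i * (s 0)⁻¹ ∈ N)
    (hr : ∀ i < m, r i * (r 0)⁻¹ ∈ N) (hsr : ⁅s 0, r 0⁆ ∈ N) : commutator G ≤ N := by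
  let π := QuotientGroup.mk' N
  have mem_iff {x y : G} : ⁅x, y⁆ ∈ N ↔ Commute (π x) (π y) := by
    rw [← commutatorElement_eq_one_iff_commute, ← map_commutatorElement, ← MonoidHom.mem_ker,
      QuotientGroup.ker_mk']
  have eq_of_mem {x y : G} (h : x * y⁻¹ ∈ N) : π x = π y := by
    rwa [← QuotientGroup.ker_mk' N, MonoidHom.mem_ker, map_mul_inv, mul_inv_eq_one] at h
  have hc : Commute (π (s 0)) (π (r 0)) := mem_iff.1 hsr
  refine commutator_le_of_closure_eq_top hgen fun x hx y hy => mem_iff.2 ?_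
  obtain ⟨i, hi, rfl⟩ | ⟨i, hi, rfl⟩ := hx <;> obtain ⟨j, hj, rfl⟩ | ⟨j, hj, rfl⟩ := hy
  · rw [eq_of_mem (hs i hi), eq_of_mem (hs j hj)]
  · rwa [eq_of_mem (hs i hi), eq_of_mem (hr j hj)]
  · rw [eq_of_mem (hr i hi), eq_of_mem (hs j hj)]
    exact hc.symm
  · rw [eq_of_mem (hr i hi), eq_of_mem (hr j hj)]

theorem Relations.commutator_le_commutator_commutator (h : Relations m s r) (hm : 4 ≤ m)
    (hgen : closure (s '' Set.Iio m ∪ r '' Set.Iio m) = ⊤) :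
    commutator G ≤ ⁅commutator G, commutator G⁆ := by
  have hs := h.ss.mul_inv_mem_of_normal (h.ss.mul_inv_mem_commutator_commutator hm)
  have hr := h.rr.mul_inv_mem_of_normal (h.rr.mul_inv_mem_commutator_commutator hm)
  refine commutator_le_of_generators hgen hs hr ?_
  have hr₀₂ : r 0 * (r 2)⁻¹ ∈ ⁅commutator G, commutator G⁆ := by
    simpa using inv_mem (hr 2 (by lia))
  have hs₀ : s 0 ∈ centralizerMod ⁅commutator G, commutator G⁆ (r 0) :=
    mem_centralizerMod_of_commute (by simp [normalizer_eq_top])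
      (h.sr.comm 0 (by lia) 2 (by lia) (by lia)).symm hr₀₂
  simpa using inv_mem hs₀.2

end Relations

section Hull

variable {G : Type*} [Group G] {L : Subgroup G} {m : ℕ} {r s t : ℕ → G} {i : ℕ}

/-- The quotients `t i * (t 0)⁻¹` of the elements of the chain `t 0, …, t (m - 1)`. -/
def ratios (m : ℕ) (t : ℕ → G) : Set G :=
  (fun i => t i * (t 0)⁻¹) '' Set.Ico 1 m

theorem finite_ratios : (ratios m t).Finite := (Set.finite_Ico 1 m).image _

theorem ncard_ratios_le : (ratios m t).ncard ≤ m - 1 := by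
  refine (Set.ncard_image_le (Set.finite_Ico 1 m)).trans_eq ?_
  simp [Set.ncard_eq_toFinset_card']

theorem mul_inv_mem_of_ratios_subset (hL : ratios m t ⊆ L) (hi : i < m) : t i * (t 0)⁻¹ ∈ L := by
  obtain rfl | hi₀ := i.eq_zero_or_pos
  · simp
  · exact hL ⟨i, ⟨hi₀, hi⟩, rfl⟩

theorem mul_inv_mem_of_ratios_subset' (hL : ratios m t ⊆ L) {j : ℕ} (hi : i < m) (hj : j < m) :
    t i * (t j)⁻¹ ∈ L := by
  simpa using mul_mem (mul_inv_mem_of_ratios_subset hL hi)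
    (inv_mem (mul_inv_mem_of_ratios_subset hL hj))

/-- For a chain `t 0, …, t (m - 1)` with `1 < m` satisfying the braid relations, the commutator
subgroup of the group that the chain generates, given by generators. -/
def braidDerived (m : ℕ) (t : ℕ → G) : Subgroup G :=
  closure (insert (t 0 * (t 1 * (t 0)⁻¹) * (t 0)⁻¹) (ratios m t))

theorem ratios_subset_braidDerived : ratios m t ⊆ braidDerived m t :=
  (Set.subset_insert _ _).trans subset_closure

theorem conj_mem_braidDerived : t 0 * (t 1 * (t 0)⁻¹) * (t 0)⁻¹ ∈ braidDerived m t :=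
  subset_closure (Set.mem_insert _ _)

theorem braidDerived_le (h : t 0 * (t 1 * (t 0)⁻¹) * (t 0)⁻¹ ∈ L) (hL : ratios m t ⊆ L) :
    braidDerived m t ≤ L :=
  (closure_le _).2 (Set.insert_subset h hL)

theorem braidDerived_le_of_mem (hm : 1 < m) (hL : ∀ i < m, t i ∈ L) : braidDerived m t ≤ L := by
  have h₀ := hL 0 (by lia)
  refine braidDerived_le
    (mul_mem (mul_mem h₀ (mul_mem (hL 1 hm) (inv_mem h₀))) (inv_mem h₀)) ?_
  rintro _ ⟨i, hi, rfl⟩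
  exact mul_mem (hL i hi.2) (inv_mem h₀)

theorem fg_braidDerived : (braidDerived m t).FG :=
  (fg_iff _).2 ⟨_, rfl, finite_ratios.insert _⟩

theorem braidDerived_le_commutator (h : Shifts m t t) (hm : 1 < m) :
    braidDerived m t ≤ commutator G := by
  refine braidDerived_le (Normal.conj_mem inferInstance _ (h.mul_inv_mem_commutator hm) _) ?_
  rintro _ ⟨i, hi, rfl⟩
  exact h.mul_inv_mem_commutator hi.2

theorem zero_mem_normalizer_braidDerived (h : Shifts m t t) (hm : 1 < m) :
    t 0 ∈ normalizer (braidDerived m t : Set G) := by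
  have mem {i : ℕ} (hi : i < m) : t i * (t 0)⁻¹ ∈ braidDerived m t :=
    mul_inv_mem_of_ratios_subset ratios_subset_braidDerived hi
  have commute {i : ℕ} (hi : i < m) (hi₂ : 2 ≤ i) : Commute (t 0) (t i * (t 0)⁻¹) :=
    (h.comm 0 (by lia) i hi (by lia)).mul_right (Commute.refl _).inv_right
  refine mem_normalizer_closure ?_ ?_ <;> rintro _ (rfl | ⟨i, ⟨hi₁, hi⟩, rfl⟩)
  · exact h.conj_conj_mul_inv hm ▸ mul_mem (inv_mem (mem hm)) conj_mem_braidDerived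
  · obtain rfl | hi₂ := hi₁.eq_or_lt
    · exact conj_mem_braidDerived
    · exact (commute hi hi₂).mul_inv_cancel ▸ mem hi
  · change _ ∈ braidDerived m t
    simpa [mul_assoc] using mem hm
  · obtain rfl | hi₂ := hi₁.eq_or_lt
    · exact h.inv_conj_mul_inv hm ▸ mul_mem (mem hm) (inv_mem conj_mem_braidDerived)
    · exact (commute hi hi₂).inv_mul_cancel ▸ mem hi

theorem mem_normalizer_braidDerived (h : Shifts m t t) (hm : 1 < m) (hi : i < m) :
    t i ∈ normalizer (braidDerived m t : Set G) :=
  mem_normalizer_of_mul_inv_mem (zero_mem_normalizer_braidDerived h hm)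
    (mul_inv_mem_of_ratios_subset ratios_subset_braidDerived hi)

theorem braidDerived_eq_closure_ratios (h : Shifts m t t) (hm : 4 ≤ m) :
    braidDerived m t = closure (ratios m t) := by
  refine le_antisymm (braidDerived_le ?_ subset_closure)
    ((closure_le _).2 ratios_subset_braidDerived)
  have c : Commute (t 3) (t 1 * (t 0)⁻¹) :=
    (h.comm 3 hm 1 (by lia) (by lia)).mul_right (h.comm 3 hm 0 (by lia) (by lia)).inv_right
  exact conj_mem_of_commute (mul_inv_mem_of_ratios_subset subset_closure (by lia)) c
    (mul_inv_mem_of_ratios_subset' subset_closure (by lia) hm)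

/-- The subgroup generated by the conjugates of `braidDerived m s` and `braidDerived m r` under the
powers of `s 0`. -/
def mixedHull (m : ℕ) (s r : ℕ → G) : Subgroup G :=
  conjClosure (s 0) (braidDerived m s ∪ braidDerived m r)

theorem braidDerived_left_le_mixedHull : braidDerived m s ≤ mixedHull m s r :=
  Set.subset_union_left.trans subset_conjClosure

theorem braidDerived_right_le_mixedHull : braidDerived m r ≤ mixedHull m s r :=
  Set.subset_union_right.trans subset_conjClosure

theorem left_mem_normalizer_mixedHull (hi : i < m) :
    s i ∈ normalizer (mixedHull m s r : Set G) :=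
  mem_normalizer_of_mul_inv_mem mem_normalizer_conjClosure (braidDerived_left_le_mixedHull
    (mul_inv_mem_of_ratios_subset ratios_subset_braidDerived hi))

namespace Relations

theorem mixedHull_le_commutator (h : Relations m s r) (hm : 1 < m) :
    mixedHull m s r ≤ commutator G :=
  conjClosure_le (Set.union_subset (braidDerived_le_commutator h.ss hm)
    (braidDerived_le_commutator h.rr hm)) (by simp [normalizer_eq_top])

theorem left_mem_centralizerMod (h : Relations m s r) (hm : 3 ≤ m) (hi : i < m) :
    s i ∈ centralizerMod (mixedHull m s r) (r 0) := by
  have r_mem : ∀ i < m, ∀ j < m, r i * (r j)⁻¹ ∈ mixedHull m s r := fun i hi j hj =>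
    braidDerived_right_le_mixedHull
      (mul_inv_mem_of_ratios_subset' ratios_subset_braidDerived hi hj)
  have norm : ∀ i < m, s i ∈ normalizer (mixedHull m s r : Set G) := fun i hi =>
    left_mem_normalizer_mixedHull hi
  have h₀ : s 0 ∈ centralizerMod (mixedHull m s r) (r 0) :=
    mem_centralizerMod_of_commute (norm 0 (by lia)) (h.sr.comm 0 (by lia) 2 hm (by lia)).symm
      (r_mem 0 (by lia) 2 hm)
  obtain rfl | rfl | hi₂ : i = 0 ∨ i = 1 ∨ 2 ≤ i := by lia
  · exact h₀
  · have e : ⁅r 0, s 1⁆ = s 1 * (s 0 * (r 1 * (r 0)⁻¹) * (s 0)⁻¹ * ⁅r 0, s 0⁆⁻¹) * (s 1)⁻¹ := by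
      have down : r 0 * s 1 = s 1 * s 0 * r 1 * (s 0)⁻¹ :=
        eq_mul_inv_of_mul_eq (by simpa [mul_assoc] using (h.sr.down 0 hi).symm)
      simp [commutatorElement_def, down, mul_assoc]
    refine ⟨norm 1 hi, e ▸ (mem_normalizer_iff.1 (norm 1 hi) _).1 (mul_mem ?_ (inv_mem h₀.2))⟩
    exact (mem_normalizer_iff.1 (norm 0 (by lia)) _).1 (r_mem 1 hi 0 (by lia))
  · exact mem_centralizerMod_of_commute (norm i hi) (h.sr.comm i hi 0 (by lia) (by lia)).symm
      (by simp)

theorem left_mem_centralizerMod_inv (h : Relations m s r) (hm : 3 ≤ m) (hi : i < m) :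
    s i ∈ centralizerMod (mixedHull m s r) (r 0)⁻¹ := by
  have r_mem : ∀ i < m, (r 0)⁻¹ * r i ∈ mixedHull m s r := fun i hi =>
    braidDerived_right_le_mixedHull
      (inv_mul_mem_of_mem_normalizer (mem_normalizer_braidDerived h.rr (by lia) hi)
        (mul_inv_mem_of_ratios_subset' ratios_subset_braidDerived (by lia) hi))
  have norm : ∀ i < m, s i ∈ normalizer (mixedHull m s r : Set G) := fun i hi =>
    left_mem_normalizer_mixedHull hi
  have h₀ : s 0 ∈ centralizerMod (mixedHull m s r) (r 0)⁻¹ :=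
    mem_centralizerMod_of_commute (norm 0 (by lia))
      (h.sr.comm 0 (by lia) 2 hm (by lia)).symm.inv_left (by simpa using r_mem 2 hm)
  obtain rfl | rfl | hi₂ : i = 0 ∨ i = 1 ∨ 2 ≤ i := by lia
  · exact h₀
  · have e : ⁅(r 0)⁻¹, s 1⁆ = ⁅(r 0)⁻¹, (s 0)⁻¹⁆ * ((s 0)⁻¹ * ((r 0)⁻¹ * r 1) * s 0) := by
      have up : r 1 * s 0 = s 0 * s 1 * r 0 * (s 1)⁻¹ :=
        eq_mul_inv_of_mul_eq (by simpa [mul_assoc] using (h.sr.up 0 hi).symm)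
      simp [commutatorElement_def, up, mul_assoc]
    exact ⟨norm 1 hi, e ▸ mul_mem (inv_mem h₀).2
      ((mem_normalizer_iff''.1 (norm 0 (by lia)) _).1 (r_mem 1 hi))⟩
  · exact mem_centralizerMod_of_commute (norm i hi)
      (h.sr.comm i hi 0 (by lia) (by lia)).symm.inv_left (by simp)

theorem right_zero_mem_normalizer_mixedHull (h : Relations m s r) (hm : 3 ≤ m) :
    r 0 ∈ normalizer (mixedHull m s r : Set G) := by
  have hr := zero_mem_normalizer_braidDerived h.rr (by lia)
  have le_comap {g : G} (hg : g ∈ normalizer (braidDerived m r : Set G))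
      (hs : ∀ i < m, s i ∈ centralizerMod (mixedHull m s r) g) :
      mixedHull m s r ≤ (mixedHull m s r).comap (MulAut.conj g).toMonoidHom := by
    refine conjClosure_le_comap_conj (hs 0 (by lia)) ?_
    rintro x (hx | hx)
    · exact conj_mem_of_mem_centralizerMod (braidDerived_left_le_mixedHull hx)
        (braidDerived_le_of_mem (by lia) hs hx)
    · exact braidDerived_right_le_mixedHull ((mem_normalizer_iff.1 hg x).1 hx)
  exact mem_normalizer_of_le_comap (le_comap hr fun i hi => h.left_mem_centralizerMod hm hi)
    (le_comap (inv_mem hr) fun i hi => h.left_mem_centralizerMod_inv hm hi)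

theorem mixedHull_eq_commutator (h : Relations m s r) (hm : 3 ≤ m)
    (hgen : closure (s '' Set.Iio m ∪ r '' Set.Iio m) = ⊤) :
    mixedHull m s r = commutator G := by
  have hs : ∀ i < m, s i * (s 0)⁻¹ ∈ mixedHull m s r := fun i hi =>
    braidDerived_left_le_mixedHull (mul_inv_mem_of_ratios_subset ratios_subset_braidDerived hi)
  have hr : ∀ i < m, r i * (r 0)⁻¹ ∈ mixedHull m s r := fun i hi =>
    braidDerived_right_le_mixedHull (mul_inv_mem_of_ratios_subset ratios_subset_braidDerived hi)
  have normal : (mixedHull m s r).Normal := by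
    rw [← normalizer_eq_top_iff, eq_top_iff, ← hgen, closure_le]
    rintro _ (⟨i, hi, rfl⟩ | ⟨i, hi, rfl⟩)
    · exact left_mem_normalizer_mixedHull hi
    · exact mem_normalizer_of_mul_inv_mem (h.right_zero_mem_normalizer_mixedHull hm) (hr i hi)
  refine le_antisymm (h.mixedHull_le_commutator (by lia))
    (commutator_le_of_generators hgen hs hr ?_)
  simpa using inv_mem (h.left_mem_centralizerMod hm (i := 0) (by lia)).2

end Relations

end Hull

section FiniteGeneration

variable {G : Type*} [Group G] {m : ℕ} {r s : ℕ → G}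

namespace Relations

theorem mixedHull_three (h : Relations 3 s r) :
    mixedHull 3 s r = conjClosure (s 0)
      (braidDerived 3 s ∪ {r 1 * (r 0)⁻¹, r 0 * (r 1 * (r 0)⁻¹) * (r 0)⁻¹}) := by
  set C := conjClosure (s 0)
    (braidDerived 3 s ∪ {r 1 * (r 0)⁻¹, r 0 * (r 1 * (r 0)⁻¹) * (r 0)⁻¹})
  have hs : braidDerived 3 s ≤ C := Set.subset_union_left.trans subset_conjClosure
  have ratio_mem : r 1 * (r 0)⁻¹ ∈ C := subset_conjClosure (by simp)
  have conj_mem : r 0 * (r 1 * (r 0)⁻¹) * (r 0)⁻¹ ∈ C := subset_conjClosure (by simp)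
  have s_mem : ∀ i < 3, s i ∈ normalizer (C : Set G) := fun i hi =>
    mem_normalizer_of_mul_inv_mem mem_normalizer_conjClosure
      (hs (mul_inv_mem_of_ratios_subset ratios_subset_braidDerived hi))
  refine le_antisymm ?_ ?_
  · refine conjClosure_le (Set.union_subset hs (braidDerived_le conj_mem ?_))
      mem_normalizer_conjClosure
    rintro _ ⟨i, ⟨hi₁, hi⟩, rfl⟩
    obtain rfl | rfl : i = 1 ∨ i = 2 := by lia
    · exact ratio_mem
    · have h₂₁ : r 2 * (r 1)⁻¹ ∈ C := h.sr.conj_mul_inv (i := 0) (by lia) ▸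
        (mem_normalizer_iff.1 (mul_mem (mul_mem (s_mem 0 (by lia)) (s_mem 1 (by lia)))
          (s_mem 2 (by lia))) _).1 ratio_mem
      simpa using mul_mem h₂₁ ratio_mem
  · refine conjClosure_le (Set.union_subset braidDerived_left_le_mixedHull ?_)
      mem_normalizer_conjClosure
    rintro _ (rfl | rfl)
    · exact braidDerived_right_le_mixedHull
        (mul_inv_mem_of_ratios_subset ratios_subset_braidDerived (by lia))
    · exact braidDerived_right_le_mixedHull conj_mem_braidDerived

/-- The product of `s 2 * s 1 * s 0` and `s 0 * s 1 * s 2` is congruent to `s 0 ^ 6` and commutes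
with `r 0` and `r 1`. -/
theorem fg_mixedHull_three (h : Relations 3 s r) : (mixedHull 3 s r).FG := by
  have hs₀ := zero_mem_normalizer_braidDerived h.ss (by lia)
  have hs : ∀ i < 3, s i * (s 0 ^ 1)⁻¹ ∈ braidDerived 3 s := fun i hi => by
    simpa using mul_inv_mem_of_ratios_subset ratios_subset_braidDerived hi
  have cube (i j k : ℕ) (hi : i < 3) (hj : j < 3) (hk : k < 3) :
      s i * s j * s k * (s 0 ^ 3)⁻¹ ∈ braidDerived 3 s :=
    mul_mul_inv_pow_mem hs₀ (mul_mul_inv_pow_mem hs₀ (hs i hi) (hs j hj)) (hs k hk)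
  have hw : s 2 * s 1 * s 0 * (s 0 * s 1 * s 2) * (s 0 ^ (3 + 3))⁻¹ ∈ braidDerived 3 s :=
    mul_mul_inv_pow_mem hs₀ (cube 2 1 0 (by lia) (by lia) (by lia))
      (cube 0 1 2 (by lia) (by lia) (by lia))
  have c₀ := h.sr.commute_three le_rfl (i := 0) (by lia)
  have c₁ := (h.sr.commute_three le_rfl (i := 1) (by lia)).mul_right c₀.inv_right
  rw [h.mixedHull_three]
  refine conjClosure_fg fg_braidDerived (Set.toFinite _) hs₀ ?_ (k := 5) hw
  rintro _ (rfl | rfl)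
  · exact c₁
  · exact (c₀.mul_right c₁).mul_right c₀.inv_right

end Relations

/-- Generators of the commutator subgroup of `GVB (m + 1)` for `4 ≤ m`. -/
def derivedGenerators (m : ℕ) (s r : ℕ → G) : Set G :=
  ratios m s ∪ insert (s 1 * (r 0 * (r 3)⁻¹) * (s 1)⁻¹) (ratios m r)

theorem finite_derivedGenerators : (derivedGenerators m s r).Finite :=
  finite_ratios.union (finite_ratios.insert _)

theorem ncard_derivedGenerators_le (hm : 1 ≤ m) :
    (derivedGenerators m s r).ncard ≤ 2 * m - 1 := by
  have hs : (ratios m s).ncard ≤ m - 1 := ncard_ratios_le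
  have hr : (ratios m r).ncard ≤ m - 1 := ncard_ratios_le
  have h₁ := Set.ncard_union_le (ratios m s)
    (insert (s 1 * (r 0 * (r 3)⁻¹) * (s 1)⁻¹) (ratios m r))
  have h₂ := Set.ncard_insert_le (s 1 * (r 0 * (r 3)⁻¹) * (s 1)⁻¹) (ratios m r)
  rw [derivedGenerators]
  lia

theorem ratios_left_subset_closure : ratios m s ⊆ closure (derivedGenerators m s r) :=
  Set.subset_union_left.trans subset_closure

theorem ratios_right_subset_closure : ratios m r ⊆ closure (derivedGenerators m s r) :=
  ((Set.subset_insert _ _).trans Set.subset_union_right).trans subset_closure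

theorem right_mul_inv_mem_closure {i j : ℕ} (hi : i < m) (hj : j < m) :
    r i * (r j)⁻¹ ∈ closure (derivedGenerators m s r) :=
  mul_inv_mem_of_ratios_subset' ratios_right_subset_closure hi hj

theorem conj_mem_closure_derivedGenerators :
    s 1 * (r 0 * (r 3)⁻¹) * (s 1)⁻¹ ∈ closure (derivedGenerators m s r) :=
  subset_closure (Or.inr (Set.mem_insert _ _))

namespace Relations

/-- The ratio `r 0 * (r 3)⁻¹` commutes with no `s k` when `m = 4`, so it is treated separately. -/
theorem conj_ratio_mem (h : Relations m s r) (hm : 4 ≤ m) {g : G}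
    (hg : ∀ k < m, ∀ x ∈ closure (derivedGenerators m s r), Commute (s k) x →
      g * x * g⁻¹ ∈ closure (derivedGenerators m s r))
    (hx : g * (r 0 * (r 3)⁻¹) * g⁻¹ ∈ closure (derivedGenerators m s r)) :
    ∀ x ∈ ratios m r, g * x * g⁻¹ ∈ closure (derivedGenerators m s r) := by
  have conj_mem (i j k : ℕ) (hi : i < m) (hj : j < m) (hk : k < m)
      (hik : k + 1 < i ∨ i + 1 < k) (hjk : k + 1 < j ∨ j + 1 < k) :
      g * (r i * (r j)⁻¹) * g⁻¹ ∈ closure (derivedGenerators m s r) :=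
    hg k hk _ (right_mul_inv_mem_closure hi hj)
      ((h.sr.comm k hk i hi hik).mul_right (h.sr.comm k hk j hj hjk).inv_right)
  rintro _ ⟨i, ⟨hi₁, hi⟩, rfl⟩
  obtain rfl | rfl | rfl | hi₄ : i = 1 ∨ i = 2 ∨ i = 3 ∨ 4 ≤ i := by lia
  · exact conj_mem 1 0 3 hi (by lia) (by lia) (by lia) (by lia)
  · simpa [mul_assoc] using
      mul_mem (conj_mem 2 3 0 hi (by lia) (by lia) (by lia) (by lia)) (inv_mem hx)
  · simpa [mul_assoc] using inv_mem hx
  · exact conj_mem i 0 2 hi (by lia) (by lia) (by lia) (by lia)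

theorem braidDerived_le_closure (h : Relations m s r) (hm : 4 ≤ m) :
    braidDerived m s ≤ closure (derivedGenerators m s r) := by
  rw [braidDerived_eq_closure_ratios h.ss hm, closure_le]
  exact ratios_left_subset_closure

theorem conj_conj_eq (h : Relations m s r) (hm : 4 ≤ m) :
    s 0 * (s 1 * (r 0 * (r 3)⁻¹) * (s 1)⁻¹) * (s 0)⁻¹ = r 1 * (r 3)⁻¹ := by
  have c₀ : Commute (s 0) (r 3)⁻¹ := (h.sr.comm 0 (by lia) 3 hm (by lia)).inv_right
  have c₁ : Commute (s 1) (r 3)⁻¹ := (h.sr.comm 1 (by lia) 3 hm (by lia)).inv_right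
  simpa [mul_assoc] using
    mul_inv_eq_of_eq_mul ((h.sr.up 0 (by lia)).mul_right (c₀.mul_left c₁)).eq

theorem inv_conj_eq (h : Relations m s r) (hm : 4 ≤ m) :
    (s 1)⁻¹ * (r 0 * (r 3)⁻¹) * s 1 = s 0 * (r 1 * (r 3)⁻¹) * (s 0)⁻¹ := by
  have c₀ : Commute (s 0) (r 3)⁻¹ := (h.sr.comm 0 (by lia) 3 hm (by lia)).inv_right
  have c₁ : Commute (s 1) (r 3)⁻¹ := (h.sr.comm 1 (by lia) 3 hm (by lia)).inv_right
  have down : s 1 * s 0 * (r 1 * (r 3)⁻¹) * (s 1 * s 0)⁻¹ = r 0 * (r 3)⁻¹ :=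
    mul_inv_eq_of_eq_mul ((h.sr.down 0 (by lia)).mul_right (c₁.mul_left c₀)).eq
  rw [← down]
  group

theorem conj_mem_closure (h : Relations m s r) (hm : 4 ≤ m) :
    ∀ x ∈ insert (s 1 * (r 0 * (r 3)⁻¹) * (s 1)⁻¹) (ratios m r),
      s 0 * x * (s 0)⁻¹ ∈ closure (derivedGenerators m s r) := by
  have s_mem {i : ℕ} (hi : i < m) : s 0 * (s i)⁻¹ ∈ closure (derivedGenerators m s r) :=
    mul_inv_mem_of_ratios_subset' ratios_left_subset_closure (by lia) hi
  rintro x (rfl | hx)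
  · exact h.conj_conj_eq hm ▸ right_mul_inv_mem_closure (by lia) hm
  · exact h.conj_ratio_mem hm (fun k hk x hx c => conj_mem_of_commute hx c (s_mem hk))
      ((conj_mem_iff_of_mul_inv_mem (s_mem (by lia))).2 conj_mem_closure_derivedGenerators) x hx

theorem inv_conj_mem_closure (h : Relations m s r) (hm : 4 ≤ m) :
    ∀ x ∈ insert (s 1 * (r 0 * (r 3)⁻¹) * (s 1)⁻¹) (ratios m r),
      (s 0)⁻¹ * x * s 0 ∈ closure (derivedGenerators m s r) := by
  have s_mem {i : ℕ} (hi : i < m) : (s 0)⁻¹ * (s i)⁻¹⁻¹ ∈ closure (derivedGenerators m s r) := by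
    rw [inv_inv]
    exact h.braidDerived_le_closure hm (inv_mul_mem_of_mem_normalizer
      (mem_normalizer_braidDerived h.ss (by lia) hi)
      (mul_inv_mem_of_ratios_subset' ratios_subset_braidDerived (by lia) hi))
  have hx₀ : (s 0)⁻¹ * (r 0 * (r 3)⁻¹) * (s 0)⁻¹⁻¹ ∈ closure (derivedGenerators m s r) := by
    rw [conj_mem_iff_of_mul_inv_mem (s_mem (i := 1) (by lia)), inv_inv, h.inv_conj_eq hm]
    have split : s 0 * (r 1 * (r 3)⁻¹) * (s 0)⁻¹ =
        s 0 * (r 1 * (r 0)⁻¹) * (s 0)⁻¹ * (s 0 * (r 3 * (r 0)⁻¹) * (s 0)⁻¹)⁻¹ := by group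
    rw [split]
    exact mul_mem (h.conj_mem_closure hm _ (Or.inr ⟨1, ⟨le_rfl, by lia⟩, rfl⟩))
      (inv_mem (h.conj_mem_closure hm _ (Or.inr ⟨3, ⟨by lia, hm⟩, rfl⟩)))
  rintro x (rfl | hx)
  · have e := conj_mem_iff_of_mul_inv_mem (x := s 1 * (r 0 * (r 3)⁻¹) * (s 1)⁻¹)
      (s_mem (i := 1) (by lia))
    rw [inv_inv, inv_inv] at e
    exact e.2 (by simpa [mul_assoc] using right_mul_inv_mem_closure (i := 0) (by lia) hm)
  · simpa using h.conj_ratio_mem hm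
      (fun k hk x hx c => conj_mem_of_commute hx c.inv_left (s_mem hk)) hx₀ x hx

theorem zero_mem_normalizer_closure (h : Relations m s r) (hm : 4 ≤ m) :
    s 0 ∈ normalizer (closure (derivedGenerators m s r) : Set G) := by
  have e : closure (derivedGenerators m s r) = braidDerived m s ⊔
      closure (insert (s 1 * (r 0 * (r 3)⁻¹) * (s 1)⁻¹) (ratios m r)) := by
    rw [derivedGenerators, Subgroup.closure_union, braidDerived_eq_closure_ratios h.ss hm]
  rw [e]
  exact mem_normalizer_sup_closure (zero_mem_normalizer_braidDerived h.ss (by lia))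
    (e ▸ h.conj_mem_closure hm) (e ▸ h.inv_conj_mem_closure hm)

theorem commutator_eq_closure (h : Relations m s r) (hm : 4 ≤ m)
    (hgen : closure (s '' Set.Iio m ∪ r '' Set.Iio m) = ⊤) :
    commutator G = closure (derivedGenerators m s r) := by
  refine le_antisymm ?_ ((closure_le _).2 ?_)
  · rw [← h.mixedHull_eq_commutator (by lia) hgen]
    refine conjClosure_le (Set.union_subset ?_ ?_) (h.zero_mem_normalizer_closure hm)
    · exact h.braidDerived_le_closure hm
    · rw [braidDerived_eq_closure_ratios h.rr hm]
      exact (closure_le _).2 ratios_right_subset_closure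
  · rintro _ (⟨i, hi, rfl⟩ | rfl | ⟨i, hi, rfl⟩)
    · exact h.ss.mul_inv_mem_commutator hi.2
    · exact Normal.conj_mem inferInstance _
        (by simpa using inv_mem (h.rr.mul_inv_mem_commutator hm)) _
    · exact h.rr.mul_inv_mem_commutator hi.2

end Relations

end FiniteGeneration

section Presentation

variable {G : Type*} [Group G] {n : ℕ} {s r : ℕ → G}

theorem semiconjBy_mul_iff {a b x y : G} : SemiconjBy (a * b) x y ↔ a * b * x = y * a * b := by
  rw [SemiconjBy, mul_assoc y]

/-- The homomorphism out of `GVB n` given by elements satisfying the defining relations. -/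
def lift (h : Relations (n - 1) s r) : GVB n →* G :=
  PresentedGroup.toGroup (rels := relators n)
    (f := fun g => match g with
      | Gen.sigma i => s i
      | Gen.rho i => r i) (by
    have far {i j : ℕ} (hij : 1 < |(i : ℤ) - j|) : i + 1 < j ∨ j + 1 < i := by grind
    rintro _ ⟨u, v, huv, rfl⟩
    rw [map_mul, map_inv, mul_inv_eq_one]
    cases huv with
    | sigma_comm i j hij =>
      simpa [σ] using (h.ss.comm i i.2 j j.2 (far hij)).eq
    | sigma_braid i j hij =>
      simpa [σ, hij, mul_assoc] using (h.ss.up i (by lia)).eq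
    | rho_comm i j hij =>
      simpa [ρ] using (h.rr.comm i i.2 j j.2 (far hij)).eq
    | rho_braid i j hij =>
      simpa [ρ, hij, mul_assoc] using (h.rr.up i (by lia)).eq
    | mixed_left i j hij =>
      simpa [σ, ρ, hij, mul_assoc] using (h.sr.down i (by lia)).eq.symm
    | mixed_right i j hij =>
      simpa [σ, ρ, hij, mul_assoc] using (h.sr.up i (by lia)).eq.symm
    | mixed_comm i j hij =>
      simpa [σ, ρ] using (h.sr.comm i i.2 j j.2 (far hij)).eq)

/-- The image of `σ_i` in `GVB n`, and `1` if the index is out of range. -/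
def sigma (n i : ℕ) : GVB n :=
  if h : i < n - 1 then PresentedGroup.of (Gen.sigma ⟨i, h⟩) else 1

/-- The image of `ρ_i` in `GVB n`, and `1` if the index is out of range. -/
def rho (n i : ℕ) : GVB n :=
  if h : i < n - 1 then PresentedGroup.of (Gen.rho ⟨i, h⟩) else 1

theorem sigma_of_lt {i : ℕ} (hi : i < n - 1) :
    sigma n i = PresentedGroup.of (Gen.sigma ⟨i, hi⟩) :=
  dif_pos hi

theorem rho_of_lt {i : ℕ} (hi : i < n - 1) : rho n i = PresentedGroup.of (Gen.rho ⟨i, hi⟩) :=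
  dif_pos hi

theorem lift_sigma (h : Relations (n - 1) s r) {i : ℕ} (hi : i < n - 1) :
    lift h (sigma n i) = s i := by
  rw [sigma_of_lt hi, lift, PresentedGroup.toGroup.of]

theorem lift_rho (h : Relations (n - 1) s r) {i : ℕ} (hi : i < n - 1) :
    lift h (rho n i) = r i := by
  rw [rho_of_lt hi, lift, PresentedGroup.toGroup.of]

theorem mk_eq_of_rel {u v : FreeGroup (Gen n)} (h : Rel n u v) :
    PresentedGroup.mk (relators n) u = PresentedGroup.mk (relators n) v := by
  rw [← mul_inv_eq_one, ← map_inv, ← map_mul]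
  exact PresentedGroup.one_of_mem ⟨u, v, h, rfl⟩

theorem relations_sigma_rho (n : ℕ) : Relations (n - 1) (sigma n) (rho n) := by
  have far {i j : ℕ} (hij : i + 1 < j ∨ j + 1 < i) : 1 < |(i : ℤ) - j| := by grind
  refine ⟨⟨fun i hi j hj hij => ?_, fun i hj => ?_, fun i hj => ?_⟩,
    ⟨fun i hi j hj hij => ?_, fun i hj => ?_, fun i hj => ?_⟩,
    ⟨fun i hi j hj hij => ?_, fun i hj => ?_, fun i hj => ?_⟩⟩
  all_goals have hi : i < n - 1 := by lia
  all_goals simp only [sigma_of_lt, rho_of_lt, hi, hj]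
  · exact mk_eq_of_rel (.sigma_comm ⟨i, hi⟩ ⟨j, hj⟩ (far hij))
  · exact semiconjBy_mul_iff.2 (mk_eq_of_rel (.sigma_braid ⟨i, hi⟩ ⟨i + 1, hj⟩ rfl))
  · exact semiconjBy_mul_iff.2 (mk_eq_of_rel (.sigma_braid ⟨i, hi⟩ ⟨i + 1, hj⟩ rfl)).symm
  · exact mk_eq_of_rel (.mixed_comm ⟨i, hi⟩ ⟨j, hj⟩ (far hij))
  · exact semiconjBy_mul_iff.2 (mk_eq_of_rel (.mixed_right ⟨i, hi⟩ ⟨i + 1, hj⟩ rfl)).symm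
  · exact semiconjBy_mul_iff.2 (mk_eq_of_rel (.mixed_left ⟨i, hi⟩ ⟨i + 1, hj⟩ rfl)).symm
  · exact mk_eq_of_rel (.rho_comm ⟨i, hi⟩ ⟨j, hj⟩ (far hij))
  · exact semiconjBy_mul_iff.2 (mk_eq_of_rel (.rho_braid ⟨i, hi⟩ ⟨i + 1, hj⟩ rfl))
  · exact semiconjBy_mul_iff.2 (mk_eq_of_rel (.rho_braid ⟨i, hi⟩ ⟨i + 1, hj⟩ rfl)).symm

theorem closure_sigma_rho (n : ℕ) :
    closure (sigma n '' Set.Iio (n - 1) ∪ rho n '' Set.Iio (n - 1)) = ⊤ := by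
  refine (eq_top_iff' _).2 (PresentedGroup.generated_by _ _ ?_)
  rintro (i | i)
  · exact subset_closure (Or.inl ⟨i, i.2, sigma_of_lt i.2⟩)
  · exact subset_closure (Or.inr ⟨i, i.2, rho_of_lt i.2⟩)

end Presentation

theorem fg_commutator {n : ℕ} (hn : 4 ≤ n) : Group.FG (commutator (GVB n)) := by
  rw [Group.fg_iff_subgroup_fg]
  have h := relations_sigma_rho n
  obtain rfl | hn := hn.eq_or_lt
  · rw [← h.mixedHull_eq_commutator (by lia) (closure_sigma_rho 4)]
    exact h.fg_mixedHull_three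
  · rw [h.commutator_eq_closure (by lia) (closure_sigma_rho n)]
    exact (fg_iff _).2 ⟨_, rfl, finite_derivedGenerators⟩

theorem rank_commutator_le {n : ℕ} (hn : 5 ≤ n) [Group.FG (commutator (GVB n))] :
    Group.rank (commutator (GVB n)) ≤ 2 * n - 3 := by
  have : Finite (derivedGenerators (n - 1) (sigma n) (rho n)) := finite_derivedGenerators
  rw [rank_congr ((relations_sigma_rho n).commutator_eq_closure (by lia) (closure_sigma_rho n))]
  refine (rank_closure_finite_le_nat_card _).trans ((ncard_derivedGenerators_le (by lia)).trans ?_)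
  lia

section Perfect

theorem isPerfect_coe_iff {G : Type*} [Group G] {H : Subgroup G} : IsPerfect H ↔ ⁅H, H⁆ = H :=
  Group.isPerfect_def.symm.trans H.isPerfect_iff

theorem isPerfect_commutator {n : ℕ} (hn : 5 ≤ n) : IsPerfect (commutator (GVB n)) :=
  isPerfect_coe_iff.2 (le_antisymm (commutator_le_left _ _)
    ((relations_sigma_rho n).commutator_le_commutator_commutator (by lia) (closure_sigma_rho n)))

open Equiv

theorem map_commutator_eq_bot {G α : Type*} [Group G] [Finite α]
    (hp : IsPerfect (commutator G)) (hα : Nat.card α ≤ 3) (f : G →* Perm α) :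
    (commutator G).map f = ⊥ := by
  classical
  have := Fintype.ofFinite α
  have : IsMulCommutative (alternatingGroup α) :=
    alternatingGroup.isMulCommutative_of_card_le_three hα
  have hA : (commutator G).map f ≤ alternatingGroup α :=
    map_le_iff_le_comap.2 (Abelianization.commutator_subset_ker (Perm.sign.comp f))
  rw [← isPerfect_coe_iff.1 hp, map_commutator, commutator_eq_bot_iff_le_centralizer]
  exact hA.trans ((le_centralizer _).trans (centralizer_le hA))

theorem relations_swap {m : ℕ} (hm : m ≤ 3) :
    Relations m (fun i => if i = 1 then swap 1 2 else swap 0 1 : ℕ → Perm (Fin 3)) 1 where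
  ss := by
    refine ⟨fun i hi j hj hij => ?_, fun i hi => ?_, fun i hi => ?_⟩
    · rw [if_neg (by lia), if_neg (by lia)]
      exact .refl _
    all_goals
      obtain rfl | rfl : i = 0 ∨ i = 1 := by lia
      all_goals change _ = _; decide
  sr := ⟨fun _ _ _ _ _ => .one_right _, fun _ _ => .one_right _, fun _ _ => .one_right _⟩
  rr := ⟨fun _ _ _ _ _ => .one_right _, fun _ _ => .one_right _, fun _ _ => .one_right _⟩

theorem not_isPerfect_commutator {n : ℕ} (hn : 3 ≤ n) (hn' : n ≤ 4) :
    ¬ IsPerfect (commutator (GVB n)) := by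
  intro hp
  let f := lift (relations_swap (m := n - 1) (by lia))
  have hf : f (sigma n 1 * (sigma n 0)⁻¹) ∈ (commutator (GVB n)).map f :=
    mem_map_of_mem f ((relations_sigma_rho n).ss.mul_inv_mem_commutator (by lia))
  rw [map_commutator_eq_bot hp (by simp), mem_bot, map_mul_inv, lift_sigma _ (by lia),
    lift_sigma _ (by lia)] at hf
  revert hf
  decide

end Perfect

section FreeQuotient

open FreeGroup (of freeGroupCongr)
open SemidirectProduct

theorem relations_const {G : Type*} [Group G] {x y : G} (h : Commute (x * x) y) :
    Relations 2 (fun _ => x) (fun _ => y) where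
  ss := ⟨fun _ _ _ _ _ => .refl x, fun _ _ => (Commute.refl x).mul_left (.refl x),
    fun _ _ => (Commute.refl x).mul_left (.refl x)⟩
  sr := ⟨fun _ _ _ _ _ => by lia, fun _ _ => h, fun _ _ => h⟩
  rr := ⟨fun _ _ _ _ _ => .refl y, fun _ _ => (Commute.refl y).mul_left (.refl y),
    fun _ _ => (Commute.refl y).mul_left (.refl y)⟩

/-- The automorphism of a free group that inverts every letter. -/
def invertLetters (α : Type*) : MulAut (FreeGroup α) :=
  MonoidHom.toMulEquiv (FreeGroup.lift fun a => (of a)⁻¹) (FreeGroup.lift fun a => (of a)⁻¹)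
    (by ext; simp) (by ext; simp)

theorem invertLetters_of {α : Type*} (a : α) : invertLetters α (of a) = (of a)⁻¹ := by
  simp [invertLetters]

/-- The automorphism of the free group on `ℤ` that shifts every letter by one. -/
def shiftLetters : MulAut (FreeGroup ℤ) :=
  freeGroupCongr (Equiv.addRight 1)

theorem shiftLetters_of (k : ℤ) : shiftLetters (of k) = of (k + 1) := by
  simp [shiftLetters]

theorem shiftLetters_pow_of (n : ℕ) (k : ℤ) : (shiftLetters ^ n) (of k) = of (k + n) := by
  induction n generalizing k with
  | zero => simp
  | succ n ih => rw [pow_succ, MulAut.mul_apply, shiftLetters_of, ih]; congr 1; push_cast; ring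

theorem commute_invertLetters_shiftLetters : Commute (invertLetters ℤ) shiftLetters := by
  refine MulEquiv.toMonoidHom_injective (FreeGroup.ext_hom _ _ fun k => ?_)
  change invertLetters ℤ (shiftLetters (of k)) = shiftLetters (invertLetters ℤ (of k))
  simp [invertLetters_of, shiftLetters_of]

/-- The holomorph of the free group on `ℤ`. -/
abbrev FreeHolomorph : Type :=
  FreeGroup ℤ ⋊[MonoidHom.id (MulAut (FreeGroup ℤ))] MulAut (FreeGroup ℤ)

/-- The element `x ↦ of 0 * invertLetters ℤ x` of the holomorph; it has order two because
`invertLetters ℤ` inverts the letter `0`. -/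
def involution : FreeHolomorph := inl (of 0) * inr (invertLetters ℤ)

theorem involution_mul_self : involution * involution = 1 := by
  have h : invertLetters ℤ * invertLetters ℤ = 1 :=
    MulEquiv.toMonoidHom_injective (FreeGroup.ext_hom _ _ fun k => by
      change invertLetters ℤ (invertLetters ℤ (of k)) = of k
      simp [invertLetters_of])
  ext1 <;> simp [involution, invertLetters_of, h]

/-- The homomorphism sending each `σ_i` to `involution` and each `ρ_i` to the shift of letters. -/
def toHolomorph : GVB 3 →* FreeHolomorph :=
  lift (n := 3) (relations_const (x := involution) (y := inr shiftLetters)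
    (involution_mul_self ▸ .one_left _))

theorem toHolomorph_sigma {i : ℕ} (hi : i < 2) : toHolomorph (sigma 3 i) = involution :=
  lift_sigma (n := 3) _ hi

theorem toHolomorph_rho {i : ℕ} (hi : i < 2) : toHolomorph (rho 3 i) = inr shiftLetters :=
  lift_rho (n := 3) _ hi

theorem commutator_le_ker_right : commutator (GVB 3) ≤ (rightHom.comp toHolomorph).ker := by
  refine commutator_le_of_generators (closure_sigma_rho 3) (fun i hi => ?_) (fun i hi => ?_) ?_
  · simp [MonoidHom.mem_ker, toHolomorph_sigma hi, toHolomorph_sigma]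
  · simp [MonoidHom.mem_ker, toHolomorph_rho hi, toHolomorph_rho]
  · rw [MonoidHom.mem_ker, map_commutatorElement, commutatorElement_eq_one_iff_commute]
    simpa [toHolomorph_sigma, toHolomorph_rho, involution] using
      commute_invertLetters_shiftLetters

theorem right_toHolomorph (g : commutator (GVB 3)) : (toHolomorph g).right = 1 :=
  commutator_le_ker_right g.2

/-- The homomorphism from the commutator subgroup of `GVB 3` to the normal free subgroup of the
holomorph. -/
def commutatorToFree : commutator (GVB 3) →* FreeGroup ℤ where
  toFun g := (toHolomorph g).left
  map_one' := by simp
  map_mul' g h := by simp [right_toHolomorph]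

theorem exists_commutatorToFree_eq (k : ℕ) :
    ∃ g, commutatorToFree g = of (k : ℤ) * (of (k + 1 : ℤ))⁻¹ := by
  have hc : ⁅sigma 3 0, rho 3 0⁆ ∈ commutator (GVB 3) :=
    commutator_mem_commutator (mem_top _) (mem_top _)
  refine ⟨⟨_, Normal.conj_mem inferInstance _ hc (rho 3 0 ^ k)⟩, ?_⟩
  have h₀ : toHolomorph ⁅sigma 3 0, rho 3 0⁆ = inl (of 0 * (of 1)⁻¹) := by
    rw [map_commutatorElement, toHolomorph_sigma (by lia), toHolomorph_rho (by lia),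
      commutatorElement_def, mul_inv_eq_iff_eq_mul, mul_inv_eq_iff_eq_mul]
    ext1
    · simp [involution, shiftLetters_of, mul_assoc]
    · simpa [involution] using commute_invertLetters_shiftLetters.eq
  have h : toHolomorph (rho 3 0 ^ k * ⁅sigma 3 0, rho 3 0⁆ * (rho 3 0 ^ k)⁻¹) =
      inl ((shiftLetters ^ k) (of 0 * (of 1)⁻¹)) := by
    rw [map_mul, map_mul, map_inv, map_pow, toHolomorph_rho (by lia), h₀, ← map_pow, ← map_inv]
    exact (inl_aut (φ := MonoidHom.id (MulAut (FreeGroup ℤ))) _ _).symm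
  change (toHolomorph _).left = _
  rw [h, left_inl, map_mul_inv, shiftLetters_pow_of, shiftLetters_pow_of, zero_add, add_comm 1]

/-- The homomorphism renaming the letter `2 * k` to `k` for `0 ≤ k` and deleting the odd letters.
The negative even letters are sent to the letter `0`. -/
def halveLetters : FreeGroup ℤ →* FreeGroup ℕ :=
  FreeGroup.lift fun k => if Even k then of (k / 2).toNat else 1

theorem surjective_halveLetters_comp :
    Function.Surjective (halveLetters.comp commutatorToFree) := by
  rw [← MonoidHom.range_eq_top, eq_top_iff, ← FreeGroup.closure_range_of, closure_le]
  rintro _ ⟨k, rfl⟩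
  obtain ⟨g, hg⟩ := exists_commutatorToFree_eq (2 * k)
  refine ⟨g, ?_⟩
  rw [MonoidHom.comp_apply, hg]
  simp [halveLetters]

theorem not_fg_freeGroup {α : Type*} [Infinite α] : ¬ Group.FG (FreeGroup α) := by
  intro h
  have : Group.FG (Abelianization (FreeGroup α)) := QuotientGroup.fg _
  have : Module.Finite ℤ (FreeAbelianGroup α) :=
    Module.Finite.iff_addGroup_fg.2 (GroupFG.iff_add_fg.1 this)
  have := Module.Finite.finite_basis (FreeAbelianGroup.basis α)
  exact not_finite α

end FreeQuotient

end GVBraid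

theorem theorem1p2 :
    -- (i) finite generation for `n ≥ 4`, and the rank bound for `n ≥ 5`
    (∀ n : ℕ, 4 ≤ n → Group.FG ↥(commutator (GVBraid.GVB n))) ∧
    (∀ n : ℕ, 5 ≤ n → ∃ _ : Group.FG ↥(commutator (GVBraid.GVB n)),
      Group.rank ↥(commutator (GVBraid.GVB n)) ≤ 3 * n - 7) ∧
    -- (ii) the case `n = 3`
    (∃ f : ↥(commutator (GVBraid.GVB 3)) →* FreeGroup ℕ, Function.Surjective f) ∧
    ¬ Group.FG ↥(commutator (GVBraid.GVB 3)) ∧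
    -- (iii) perfectness
    (∀ n : ℕ, 3 ≤ n → (GVBraid.IsPerfect ↥(commutator (GVBraid.GVB n)) ↔ 5 ≤ n)) := by
  have surj := GVBraid.surjective_halveLetters_comp
  refine ⟨fun n hn => GVBraid.fg_commutator hn, fun n hn => ?_, ⟨_, surj⟩, fun h => ?_,
    fun n hn => ⟨fun hp => ?_, fun hn => GVBraid.isPerfect_commutator hn⟩⟩
  · have := GVBraid.fg_commutator (n := n) (by lia)
    exact ⟨this, (GVBraid.rank_commutator_le hn).trans (by lia)⟩
  · exact GVBraid.not_fg_freeGroup (Group.fg_of_surjective surj)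
  · by_contra hn'
    exact GVBraid.not_isPerfect_commutator hn (by lia) hp
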